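/- Let $d\ge 1$ and let $T=\{T^{\vec v}\}_{\vec v\in\mathbb Z^d}$ be a free measure preserving $\mathbb Z^d$ action on a Lebesgue probability space $(X,\mathcal A,\mu)$. Definitions. A tower of shape $R$ (a finite subset of $\mathbb Z^d$) and base $B\in\mathcal A$, $\mu(B)>0$, is given when the sets $T^{\vec v}B$, $\vec v\in R$, are pairwise disjoint; its atoms are these sets and the error set $\big(\bigcup_{\vec v\in R}T^{\vec v}B\big)^c$. The action is $\{R_k\}$ rank one if there are towers $\mathcal P_k$ of shape $R_k$ such that for every $A\in\mathcal A$ there are unions $A_k$ of atoms of $\mathcal P_k$ with $\mu(A_k\triangle A)\to 0$. It is rectangular rank one if it is $\{R_k\}$ rank one for some sequence of rectangles $R_k=[\vec m_k,\vec n_k]=\{\vec v\in\mathbb Z^d:\vec m_k\le\vec v\le\vec n_k\}$ (coordinatewise order, $\vec m_k\le\vec n_k$) which is a Følner sequence, i.e. $|R_k\triangle(R_k+\vec n)|/|R_k|\to 0$ for every $\vec n\in\mathbb Z^d$. For an $n$-dimensional subspace $V$ of $\mathbb R^d$ let $Q$ be a unit cube in $V$ with a vertex at $\vec 0$, let $Q'$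 be a unit cube in $V^\perp$ centered at $\vec 0$, let $S(V,t,m)=tQ+mQ'$, and for a finite measurable partition $\mathcal P$ let $\mathcal P_{V,t,m}=\bigvee_{\vec w\in S(V,t,m)\cap\mathbb Z^d}T^{-\vec w}\mathcal P$. With $H(\mathcal P)=-\sum_{P\in\mathcal P}\mu(P)\log\mu(P)$, put $$h_n(T,V)=\sup_{\mathcal P\text{ finite}}\ \sup_{m>0}\ \limsup_{t\to\infty}\frac1{t^n}H(\mathcal P_{V,t,m})$$ (the value does not depend on the choice of the cubes; formally, one also takes the supremum over these choices). Theorem. Suppose $T$ is rectangular rank one. Then there is a one-dimensional subspace $V$ of $\mathbb R^d$ with $h_1(T,V)=0$. Moreover, whenever $T$ is $\{R_k\}$ rank one for a Følner sequence of rectangles $R_k=[\vec m_k,\vec n_k]$, and $i\in\{1,\dots,d\}$ is such that for infinitely many $k$ the $i$-th side is a longest one, that is, $(\vec n_k-\vec m_k)_i=\max_{j}(\vec n_k-\vec m_k)_j$, then $h_1(T,\mathbb R\vec e_i)=0$, where $\vec e_i$ is the $i$-th standard basis vector. -/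

import Mathlib

open MeasureTheory Filter Topology
open scoped ENNReal Pointwise symmDiff

noncomputable section

namespace RankOne

/-! ### Lebesgue spaces and free actions

A `ℤ^d` action `T` on `X` is an `AddAction (Fin d → ℤ) X`, with `T^v x = v +ᵥ x`. -/

/-- `(X, μ)` is a Lebesgue space: up to null sets and completion it is isomorphic to the real
line with a Borel measure. The isomorphism is `f`, a measurable map that is injective on a set
`X₀` of full measure and sends measurable subsets of `X₀` to sets measurable for the
completion of the image measure. Every standard Borel space qualifies, and so does its
completion. -/
def IsLebesgueSpace {X : Type*} [MeasurableSpace X] (μ : Measure X) : Prop :=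
  ∃ (f : X → ℝ) (X₀ : Set X), Measurable f ∧ (∀ᵐ x ∂μ, x ∈ X₀) ∧ Set.InjOn f X₀ ∧
    ∀ A : Set X, MeasurableSet A → NullMeasurableSet (f '' (A ∩ X₀)) (μ.map f)

/-- The action is (essentially) free: almost every point has trivial stabilizer. -/
def IsFree (d : ℕ) {X : Type*} [MeasurableSpace X] (μ : Measure X)
    [AddAction (Fin d → ℤ) X] : Prop :=
  ∀ᵐ x ∂μ, ∀ v : Fin d → ℤ, v +ᵥ x = x → v = 0

/-! ### Shapes -/

/-- A Følner sequence of shapes: `|R_k ∆ (R_k + n)| / |R_k| → 0` for every `n ∈ ℤ^d`. -/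
def IsFolner {d : ℕ} (R : ℕ → Finset (Fin d → ℤ)) : Prop :=
  ∀ n : Fin d → ℤ, Tendsto
    (fun k => (((R k) ∆ ((R k).image fun v => v + n)).card : ℝ) / ((R k).card : ℝ))
    atTop (𝓝 0)

/-! ### Towers and rank one -/

/-- `B` is the base of a tower of shape `R`. -/
structure IsTowerBase {d : ℕ} {X : Type*} [MeasurableSpace X] [AddAction (Fin d → ℤ) X]
    (μ : Measure X) (R : Finset (Fin d → ℤ)) (B : Set X) : Prop where
  measurableSet : MeasurableSet B
  measure_pos : 0 < μ B
  disjoint : ∀ v ∈ R, ∀ w ∈ R, v ≠ w → Disjoint (v +ᵥ B) (w +ᵥ B)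

/-- The atoms of the tower partition of shape `R` and base `B`. The alphabet is `R` together
with one more symbol, here `none`, for the error set. -/
def towerAtom {d : ℕ} {X : Type*} [AddAction (Fin d → ℤ) X]
    (R : Finset (Fin d → ℤ)) (B : Set X) : Option R → Set X
  | some v => (v : Fin d → ℤ) +ᵥ B
  | none => (⋃ v ∈ R, v +ᵥ B)ᶜ

/-- For a sequence of partitions (given by their labelled atoms), `P_k → ε`: every measurable
set is asymptotically a union of atoms of `P_k`. -/
def TendstoPoints {X : Type*} [MeasurableSpace X] (μ : Measure X) {L : ℕ → Type*}
    (P : ∀ k, L k → Set X) : Prop :=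
  ∀ A : Set X, MeasurableSet A → ∃ I : ∀ k, Set (L k),
    Tendsto (fun k => μ ((⋃ a ∈ I k, P k a) ∆ A)) atTop (𝓝 0)

/-- The action is `R`-rank one: there are towers `P_k` of shape `R_k` with `P_k → ε`. -/
def IsRankOne {d : ℕ} {X : Type*} [MeasurableSpace X] [AddAction (Fin d → ℤ) X]
    (μ : Measure X) (R : ℕ → Finset (Fin d → ℤ)) : Prop :=
  ∃ B : ℕ → Set X, (∀ k, IsTowerBase μ (R k) (B k)) ∧
    TendstoPoints μ (fun k => towerAtom (R k) (B k))

/-- The action is rectangular rank one: it is `R`-rank one for a Følner sequence of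
rectangles `R_k = [m_k, n_k]`. -/
def IsRectangularRankOne (d : ℕ) {X : Type*} [MeasurableSpace X] [AddAction (Fin d → ℤ) X]
    (μ : Measure X) : Prop :=
  ∃ m n : ℕ → Fin d → ℤ, (∀ k, m k ≤ n k) ∧ IsFolner (fun k => Finset.Icc (m k) (n k)) ∧
    IsRankOne μ (fun k => Finset.Icc (m k) (n k))

/-! ### Entropy of partitions -/

/-- The entropy `-∑ μ(P_a) log μ(P_a)` of a finite partition `P : X → L`. -/
def partitionEntropy {X : Type*} [MeasurableSpace X] (μ : Measure X)
    {L : Type*} [Fintype L] (P : X → L) : ℝ :=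
  ∑ a : L, Real.negMulLog (μ.real (P ⁻¹' {a}))

/-- The join `⋁_{w ∈ F} T^{-w} P`; the atom of `T^{-w} P` with label `a` is `T^{-w} P_a`, so
that `T^{-w} P` is the function `x ↦ P (T^w x)`. -/
def joinPartition {d : ℕ} {X : Type*} [AddAction (Fin d → ℤ) X] {L : Type*}
    (F : Finset (Fin d → ℤ)) (P : X → L) : X → (F → L) :=
  fun x w => P ((w : Fin d → ℤ) +ᵥ x)

/-! ### Directional entropy -/

section Box

variable {d : ℕ} {V : Submodule ℝ (EuclideanSpace ℝ (Fin d))}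

/-- `S(V,t,m) = tQ + mQ'`, where `Q` is the unit cube in `V` spanned by the orthonormal basis
`b` of `V` and `Q'` is the unit cube in `Vᗮ` with edges along the orthonormal basis `b'` of
`Vᗮ` and centre `0`. -/
def tiltedBox (b : OrthonormalBasis (Fin (Module.finrank ℝ V)) ℝ V)
    (b' : OrthonormalBasis (Fin (Module.finrank ℝ Vᗮ)) ℝ Vᗮ) (t m : ℝ) :
    Set (EuclideanSpace ℝ (Fin d)) :=
  t • ((fun s : Fin (Module.finrank ℝ V) → ℝ =>
      ∑ i, s i • (b i : EuclideanSpace ℝ (Fin d))) '' Set.Icc 0 1) +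
  m • ((fun s : Fin (Module.finrank ℝ Vᗮ) → ℝ =>
      ∑ i, s i • (b' i : EuclideanSpace ℝ (Fin d))) ''
        Set.Icc (fun _ => -(1 / 2 : ℝ)) (fun _ => (1 / 2 : ℝ)))

theorem tiltedBox_finite (b : OrthonormalBasis (Fin (Module.finrank ℝ V)) ℝ V)
    (b' : OrthonormalBasis (Fin (Module.finrank ℝ Vᗮ)) ℝ Vᗮ) (t m : ℝ) :
    {w : Fin d → ℤ |
      (WithLp.toLp 2 (fun i => (w i : ℝ)) : EuclideanSpace ℝ (Fin d)) ∈
        tiltedBox b b' t m}.Finite := by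
  have hc : IsCompact (tiltedBox b b' t m) := by
    unfold tiltedBox
    refine IsCompact.add (IsCompact.smul _ (IsCompact.image isCompact_Icc ?_))
      (IsCompact.smul _ (IsCompact.image isCompact_Icc ?_)) <;> fun_prop
  obtain ⟨C, hC⟩ := hc.isBounded.exists_norm_le
  refine (Set.finite_Icc (fun _ : Fin d => -⌈C⌉) (fun _ => ⌈C⌉)).subset ?_
  intro w hw
  have key : ∀ i, |(w i : ℝ)| ≤ (⌈C⌉ : ℤ) := fun i => by
    have h1 := PiLp.norm_apply_le
      (WithLp.toLp 2 (fun i => (w i : ℝ)) : EuclideanSpace ℝ (Fin d)) i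
    rw [Real.norm_eq_abs] at h1
    exact (h1.trans (hC _ hw)).trans (Int.le_ceil C)
  constructor <;> intro i <;> have h := abs_le.mp (key i)
  · exact_mod_cast h.1
  · exact_mod_cast h.2

/-- The lattice points `S(V,t,m) ∩ ℤ^d`. -/
def latticeBox (b : OrthonormalBasis (Fin (Module.finrank ℝ V)) ℝ V)
    (b' : OrthonormalBasis (Fin (Module.finrank ℝ Vᗮ)) ℝ Vᗮ) (t m : ℝ) :
    Finset (Fin d → ℤ) :=
  (tiltedBox_finite b b' t m).toFinset

end Box

/-- `h_n(T,V,P,m) = limsup_{t → ∞} t^{-n} H(P_{V,t,m})`, where `n = dim V`, for the cubes given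
by the orthonormal bases `b` of `V` and `b'` of `Vᗮ`. -/
def directionalEntropyAt {d : ℕ} {X : Type*} [MeasurableSpace X] [AddAction (Fin d → ℤ) X]
    (μ : Measure X) {V : Submodule ℝ (EuclideanSpace ℝ (Fin d))}
    (b : OrthonormalBasis (Fin (Module.finrank ℝ V)) ℝ V)
    (b' : OrthonormalBasis (Fin (Module.finrank ℝ Vᗮ)) ℝ Vᗮ)
    {L : Type*} [Fintype L] (P : X → L) (m : ℝ) : ℝ≥0∞ :=
  limsup (fun t : ℝ => ENNReal.ofReal
    (partitionEntropy μ (joinPartition (latticeBox b b' t m) P) /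
      t ^ Module.finrank ℝ V)) atTop

/-- `h_n(T,V) = sup_P sup_{m > 0} h_n(T,V,P,m)` with `n = dim V`, over all finite measurable
partitions `P`. The value does not depend on the choice of unit cubes in `V` and `Vᗮ`; the
supremum over all choices makes the definition free of a choice. -/
def directionalEntropy {d : ℕ} {X : Type*} [MeasurableSpace X] [AddAction (Fin d → ℤ) X]
    (μ : Measure X) (V : Submodule ℝ (EuclideanSpace ℝ (Fin d))) : ℝ≥0∞ :=
  ⨆ (b : OrthonormalBasis (Fin (Module.finrank ℝ V)) ℝ V)
    (b' : OrthonormalBasis (Fin (Module.finrank ℝ Vᗮ)) ℝ Vᗮ)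
    (N : ℕ) (P : X → Fin N) (_ : Measurable P) (m : ℝ) (_ : 0 < m),
    directionalEntropyAt μ b b' P m

end RankOne

end

/-! Follow an orbit in direction `e_i` through a tower over a rectangle with sides of length `l_j`.
Each step inside the tower raises the level by `e_i`, so the level is predictable except on entry,
when it lies in the face `v i = m i`. The tower names along `N` steps are thus determined by the
initial level and `N` entrance labels (`towerLabel_single_vadd`, `partitionEntropy_line_le`).

The entrance face has `|R| / l_i` levels, each of measure at most `1 / |R|`. If side `i` is a
longest one, then `|R| ≤ l_i ^ d`, and the entrance labels have entropy at most `(d log l_i + 1) /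
l_i` (`partitionEntropy_faceLabel_le`). The Følner condition forces `l_i → ∞`
(`inv_side_le_folner`), so this cost per step is arbitrarily small.

Any finite partition is a function of the tower label outside a set of small measure, and a
correction of small entropy repairs the rest. Hence its names along the axis have entropy at most `c
+ N ε` (`exists_partitionEntropy_line_le`). The lattice points of `S(V,t,m)` lie in a tube of
bounded width around the axis, so a name over them is read off from a line name of length `O(t)` for
a join over a fixed cross-section. -/

namespace RankOne

/-! ### Entropy of finite partitions -/

section Entropy

variable {X : Type*} [MeasurableSpace X] {μ : Measure X}
  {L L' : Type*}

/-- Partitions are label functions with measurable fibres, so that label types need no σ-algebra. -/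
theorem measurableSet_fiber_prodMk {P : X → L} {Q : X → L'}
    (hP : ∀ a, MeasurableSet (P ⁻¹' {a})) (hQ : ∀ a, MeasurableSet (Q ⁻¹' {a})) (c : L × L') :
    MeasurableSet ((fun x => (P x, Q x)) ⁻¹' {c}) := by
  convert (hP c.1).inter (hQ c.2)
  ext x
  simp [Prod.ext_iff]

theorem measurableSet_fiber_pi {ι : Type*} [Finite ι] {Q : ι → X → L}
    (hQ : ∀ i a, MeasurableSet (Q i ⁻¹' {a})) (c : ι → L) :
    MeasurableSet ((fun x i => Q i x) ⁻¹' {c}) := by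
  convert MeasurableSet.iInter fun i => hQ i (c i)
  ext x
  simp [funext_iff]

variable [Fintype L] [Fintype L']

theorem negMulLog_sum_le {ι : Type*} (s : Finset ι) (p : ι → ℝ) (hp : ∀ a ∈ s, 0 ≤ p a) :
    Real.negMulLog (∑ a ∈ s, p a) ≤ ∑ a ∈ s, Real.negMulLog (p a) := by
  rw [Real.negMulLog, ← Finset.sum_neg_distrib, Finset.sum_mul]
  refine Finset.sum_le_sum fun a ha => ?_
  rcases (hp a ha).eq_or_lt with h | h
  · simp [← h]
  · have hle : p a ≤ ∑ a ∈ s, p a := Finset.single_le_sum hp ha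
    have := Real.log_le_log h hle
    rw [Real.negMulLog]
    nlinarith

theorem negMulLog_le_one_sub {y : ℝ} (hy : 0 ≤ y) : Real.negMulLog y ≤ 1 - y := by
  rcases hy.eq_or_lt with h | h
  · simp [← h]
  · have h1 := Real.one_sub_inv_le_log_of_pos h
    have h2 : y * (1 - y⁻¹) ≤ y * Real.log y := mul_le_mul_of_nonneg_left h1 hy
    have h3 : y * (1 - y⁻¹) = y - 1 := by field_simp
    rw [Real.negMulLog]
    linarith

theorem negMulLog_le_negMulLog {x y : ℝ} (hx : 0 ≤ x) (hxy : x ≤ y) (hy : y ≤ Real.exp (-1)) :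
    Real.negMulLog x ≤ Real.negMulLog y := by
  have hneg : ∀ z, Real.negMulLog z = -(z * Real.log z) := fun z => by
    rw [Real.negMulLog]; ring
  rw [hneg, hneg, neg_le_neg_iff]
  exact Real.mul_log_strictAntiOn.antitoneOn ⟨hx, hxy.trans hy⟩ ⟨hx.trans hxy, hy⟩ hxy

theorem sum_measureReal_fiber [IsFiniteMeasure μ] {P : X → L}
    (hP : ∀ a, MeasurableSet (P ⁻¹' {a})) (S : Set X) :
    ∑ a, μ.real (S ∩ P ⁻¹' {a}) = μ.real S := by
  have h := measureReal_biUnion_finset (μ := μ.restrict S) (s := (Finset.univ : Finset L))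
    (f := fun a => P ⁻¹' {a}) (fun a _ b _ hab => by
      simp only [Function.onFun]
      exact (Set.disjoint_singleton.mpr hab).preimage P) (fun a _ => hP a)
  have h2 : (⋃ a ∈ (Finset.univ : Finset L), P ⁻¹' {a}) = Set.univ := by
    ext x; simp
  rw [h2, measureReal_restrict_apply_univ] at h
  rw [h]
  refine Finset.sum_congr rfl fun a _ => ?_
  rw [measureReal_restrict_apply (hP a), Set.inter_comm]

/-- Coarsening a partition decreases its entropy. -/
theorem partitionEntropy_comp_le [IsFiniteMeasure μ] {P : X → L}
    (hP : ∀ a, MeasurableSet (P ⁻¹' {a})) (f : L → L') :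
    partitionEntropy μ (fun x => f (P x)) ≤ partitionEntropy μ P := by
  classical
  unfold partitionEntropy
  rw [← Finset.sum_fiberwise Finset.univ f]
  refine Finset.sum_le_sum fun b _ => ?_
  refine le_trans (le_of_eq ?_) (negMulLog_sum_le _ _ fun _ _ => measureReal_nonneg)
  congr 1
  rw [← sum_measureReal_fiber hP, Finset.sum_filter]
  refine Finset.sum_congr rfl fun a _ => ?_
  split_ifs with h
  · congr 1
    ext x
    simp only [Set.mem_inter_iff, Set.mem_preimage, Set.mem_singleton_iff]
    exact ⟨fun h => h.2, fun hx => ⟨by rw [hx, h], hx⟩⟩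
  · convert measureReal_empty (μ := μ)
    ext x
    simp only [Set.mem_inter_iff, Set.mem_preimage, Set.mem_singleton_iff,
      Set.mem_empty_iff_false, iff_false, not_and]
    rintro hx rfl
    exact h hx

/-- This is `log x ≤ x - 1` at `x = p q / r`, multiplied by `r`: the termwise form of nonnegativity
of mutual information. Summed over a joint distribution `r` with marginals `p` and `q`, the last two
terms cancel. -/
theorem negMulLog_le_of_le {r p q : ℝ} (hr : 0 ≤ r) (hp : r ≤ p) (hq : r ≤ q) :
    Real.negMulLog r ≤ -(r * Real.log p) - r * Real.log q + p * q - r := by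
  rcases hr.eq_or_lt with h | h
  · subst h
    simpa using mul_nonneg hp hq
  · have hp' := h.trans_le hp
    have hq' := h.trans_le hq
    have h1 := Real.log_le_sub_one_of_pos (show 0 < p * q / r by positivity)
    rw [Real.log_div (by positivity) h.ne', Real.log_mul hp'.ne' hq'.ne'] at h1
    have h2 := mul_le_mul_of_nonneg_left h1 hr
    have h3 : r * (p * q / r - 1) = p * q - r := by field_simp
    rw [h3] at h2
    rw [Real.negMulLog]
    linarith

/-- Entropy is subadditive under joins. -/
theorem partitionEntropy_prodMk_le [IsProbabilityMeasure μ] {P : X → L} {Q : X → L'}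
    (hP : ∀ a, MeasurableSet (P ⁻¹' {a})) (hQ : ∀ a, MeasurableSet (Q ⁻¹' {a})) :
    partitionEntropy μ (fun x => (P x, Q x)) ≤ partitionEntropy μ P + partitionEntropy μ Q := by
  set r : L → L' → ℝ := fun a b => μ.real (P ⁻¹' {a} ∩ Q ⁻¹' {b}) with hr
  have hr' : ∀ c : L × L', μ.real ((fun x => (P x, Q x)) ⁻¹' {c}) = r c.1 c.2 := fun c => by
    rw [hr]
    congr 1
    ext x
    simp [Prod.ext_iff]
  have hp : ∀ a, ∑ b, r a b = μ.real (P ⁻¹' {a}) := fun a => sum_measureReal_fiber hQ _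
  have hq : ∀ b, ∑ a, r a b = μ.real (Q ⁻¹' {b}) := fun b => by
    rw [← sum_measureReal_fiber hP]
    exact Finset.sum_congr rfl fun a _ => by rw [hr, Set.inter_comm]
  have hp1 : ∑ a, μ.real (P ⁻¹' {a}) = 1 := by
    simpa using sum_measureReal_fiber (μ := μ) hP Set.univ
  have hq1 : ∑ a, μ.real (Q ⁻¹' {a}) = 1 := by
    simpa using sum_measureReal_fiber (μ := μ) hQ Set.univ
  have key : ∀ a b, Real.negMulLog (r a b) ≤ -(r a b * Real.log (μ.real (P ⁻¹' {a})))
      - r a b * Real.log (μ.real (Q ⁻¹' {b}))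
      + μ.real (P ⁻¹' {a}) * μ.real (Q ⁻¹' {b}) - r a b := fun a b =>
    negMulLog_le_of_le measureReal_nonneg (measureReal_mono Set.inter_subset_left)
      (measureReal_mono Set.inter_subset_right)
  unfold partitionEntropy
  simp_rw [hr']
  rw [Fintype.sum_prod_type]
  refine (Finset.sum_le_sum fun a _ => Finset.sum_le_sum fun b _ => key a b).trans (le_of_eq ?_)
  simp only [Finset.sum_sub_distrib, Finset.sum_add_distrib, Finset.sum_neg_distrib]
  have e1 : ∑ a, ∑ b, r a b * Real.log (μ.real (P ⁻¹' {a}))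
      = -∑ a, Real.negMulLog (μ.real (P ⁻¹' {a})) := by
    rw [← Finset.sum_neg_distrib]
    refine Finset.sum_congr rfl fun a _ => ?_
    rw [← Finset.sum_mul, hp, Real.negMulLog]; ring
  have e2 : ∑ a, ∑ b, r a b * Real.log (μ.real (Q ⁻¹' {b}))
      = -∑ b, Real.negMulLog (μ.real (Q ⁻¹' {b})) := by
    rw [Finset.sum_comm, ← Finset.sum_neg_distrib]
    refine Finset.sum_congr rfl fun b _ => ?_
    rw [← Finset.sum_mul, hq, Real.negMulLog]; ring
  have e3 : ∑ a, ∑ b, μ.real (P ⁻¹' {a}) * μ.real (Q ⁻¹' {b}) = 1 := by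
    rw [← Finset.sum_mul_sum, hp1, hq1, one_mul]
  have e4 : ∑ a, ∑ b, r a b = 1 := by
    simp_rw [hp, hp1]
  rw [e1, e2, e3, e4]; ring

theorem partitionEntropy_pi_le [IsProbabilityMeasure μ] {n : ℕ} {Q : Fin n → X → L}
    (hQ : ∀ i a, MeasurableSet (Q i ⁻¹' {a})) :
    partitionEntropy μ (fun x i => Q i x) ≤ ∑ i, partitionEntropy μ (Q i) := by
  induction n with
  | zero =>
    have h : ∀ a : Fin 0 → L, (fun x (i : Fin 0) => Q i x) ⁻¹' {a} = Set.univ := fun a => by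
      ext x; simpa using Subsingleton.elim _ _
    simp [partitionEntropy, h]
  | succ n ih =>
    rw [Fin.sum_univ_succ]
    refine le_trans ?_ ((partitionEntropy_prodMk_le (hQ 0)
      (measurableSet_fiber_pi fun i => hQ (Fin.succ i))).trans
      (add_le_add le_rfl (ih fun i => hQ i.succ)))
    have h := partitionEntropy_comp_le (μ := μ) (measurableSet_fiber_prodMk (hQ 0)
      (measurableSet_fiber_pi fun i => hQ (Fin.succ i)))
      (fun c : L × (Fin n → L) => (Fin.cons c.1 c.2 : Fin (n + 1) → L))
    refine le_of_eq_of_le ?_ h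
    congr 1
    funext x i
    refine Fin.cases ?_ (fun j => ?_) i <;> simp

/-- A partition with all but one of its atoms small and few has small entropy. -/
theorem partitionEntropy_option_le [IsProbabilityMeasure μ] {P : X → Option L}
    (hP : ∀ a, MeasurableSet (P ⁻¹' {a})) (S : Finset L) (hS : ∀ a ∉ S, P ⁻¹' {some a} = ∅)
    {q : ℝ} (hq : q ≤ Real.exp (-1)) (hPq : ∀ a, μ.real (P ⁻¹' {some a}) ≤ q) :
    partitionEntropy μ P ≤ S.card * (Real.negMulLog q + q) := by
  have htot := sum_measureReal_fiber (μ := μ) hP Set.univ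
  simp only [Set.univ_inter, probReal_univ, Fintype.sum_option] at htot
  have hsum : ∀ f : ℝ → ℝ, f 0 = 0 →
      ∑ a, f (μ.real (P ⁻¹' {some a})) = ∑ a ∈ S, f (μ.real (P ⁻¹' {some a})) := fun f hf =>
    (Finset.sum_subset (Finset.subset_univ S) fun a _ ha => by
      rw [hS a ha, measureReal_empty, hf]).symm
  rw [hsum (fun y => y) rfl] at htot
  rw [partitionEntropy, Fintype.sum_option, hsum _ Real.negMulLog_zero]
  -- The atom of label `none` contributes at most the total mass of the other atoms, which accounts
  -- for the extra `q` per label.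
  have h0 := negMulLog_le_one_sub (measureReal_nonneg (μ := μ) (s := P ⁻¹' {none}))
  have h1 : ∑ a ∈ S, μ.real (P ⁻¹' {some a}) ≤ S.card * q := by
    rw [← nsmul_eq_mul]; exact Finset.sum_le_card_nsmul _ _ _ fun a _ => hPq a
  have h2 : ∑ a ∈ S, Real.negMulLog (μ.real (P ⁻¹' {some a})) ≤ S.card * Real.negMulLog q := by
    rw [← nsmul_eq_mul]
    exact Finset.sum_le_card_nsmul _ _ _ fun a _ =>
      negMulLog_le_negMulLog measureReal_nonneg (hPq a) hq
  rw [mul_add]; linarith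

end Entropy

/-! ### Entropy along a line -/

section Line

/-- A sequence following a recursion driven by `f` is a function of its first term and of `f`. -/
theorem exists_reconstruction {A C : Type*} (step : A → C → A) (n : ℕ) :
    ∃ G : A → (Fin n → C) → ℕ → A, ∀ (u : ℕ → A) (f : ℕ → C),
      (∀ s, u (s + 1) = step (u s) (f s)) → ∀ s ≤ n, u s = G (u 0) (fun j => f j) s := by
  -- The value `b` kept beyond the end of the data is never read for `s ≤ n`.
  refine ⟨fun a c s => Nat.rec a (fun s b => if h : s < n then step b (c ⟨s, h⟩) else b) s,
    fun u f huf s => ?_⟩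
  induction s with
  | zero => intro _; rfl
  | succ s ih =>
    intro hs
    have hs' : s < n := hs
    rw [huf, ih hs'.le]
    simp [hs']

variable {d : ℕ} {X : Type*} [MeasurableSpace X] {μ : Measure X}
  [AddAction (Fin d → ℤ) X] {L : Type*}

theorem partitionEntropy_vadd [Fintype L] [VAddInvariantMeasure (Fin d → ℤ) X μ]
    (P : X → L) (v : Fin d → ℤ) :
    partitionEntropy μ (fun x => P (v +ᵥ x)) = partitionEntropy μ P := by
  unfold partitionEntropy
  refine Finset.sum_congr rfl fun a _ => ?_
  congr 1
  simp only [Measure.real]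
  rw [← measure_preimage_vadd (μ := μ) v (P ⁻¹' {a})]
  rfl

variable [MeasurableConstVAdd (Fin d → ℤ) X]

theorem measurableSet_fiber_vadd {P : X → L} (hP : ∀ a, MeasurableSet (P ⁻¹' {a}))
    (v : Fin d → ℤ) (a : L) : MeasurableSet ((fun x => P (v +ᵥ x)) ⁻¹' {a}) :=
  measurable_const_vadd v (hP a)

theorem measurableSet_fiber_joinPartition {P : X → L} (hP : ∀ a, MeasurableSet (P ⁻¹' {a}))
    (C : Finset (Fin d → ℤ)) (c : C → L) : MeasurableSet (joinPartition C P ⁻¹' {c}) :=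
  measurableSet_fiber_pi (Q := fun (w : C) x => P ((w : Fin d → ℤ) +ᵥ x))
    (fun w => measurableSet_fiber_vadd hP (w : Fin d → ℤ)) c

variable [IsProbabilityMeasure μ] [Fintype L]

/-- Entropy of the names of length `n + 1` along the line through `v` in direction `e`, for a
partition that is a function of a partition `P`, predictable from its past and `F`, and of `E`. -/
theorem partitionEntropy_line_le [VAddInvariantMeasure (Fin d → ℤ) X μ]
    {A C D : Type*} [Fintype A] [Fintype C] [Fintype D]
    {P : X → A} {F : X → C} {E : X → D}
    (hP : ∀ a, MeasurableSet (P ⁻¹' {a})) (hF : ∀ a, MeasurableSet (F ⁻¹' {a}))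
    (hE : ∀ a, MeasurableSet (E ⁻¹' {a})) (e : Fin d → ℤ) (step : A → C → A)
    (hstep : ∀ x, P (e +ᵥ x) = step (P x) (F (e +ᵥ x))) (g : A → D → L)
    (v : Fin d → ℤ) (n : ℕ) :
    partitionEntropy μ (fun x (s : Fin (n + 1)) =>
        g (P ((v + (s : ℕ) • e) +ᵥ x)) (E ((v + (s : ℕ) • e) +ᵥ x))) ≤
      partitionEntropy μ P + n * partitionEntropy μ F + (n + 1) * partitionEntropy μ E := by
  obtain ⟨G, hG⟩ := exists_reconstruction step n
  -- The shift is by `s + 1`, since `hstep` reads `F` at the point reached by the step.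
  have hF' : ∀ (s : Fin n) a,
      MeasurableSet ((fun x => F ((v + ((s : ℕ) + 1) • e) +ᵥ x)) ⁻¹' {a}) :=
    fun s a => measurableSet_fiber_vadd hF _ a
  have hE' : ∀ (s : Fin (n + 1)) a,
      MeasurableSet ((fun x => E ((v + (s : ℕ) • e) +ᵥ x)) ⁻¹' {a}) :=
    fun s a => measurableSet_fiber_vadd hE _ a
  have hPF := measurableSet_fiber_prodMk (measurableSet_fiber_vadd hP v)
    (measurableSet_fiber_pi hF')
  have hmono := partitionEntropy_comp_le (μ := μ)
    (measurableSet_fiber_prodMk hPF (measurableSet_fiber_pi hE'))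
    (fun c (s : Fin (n + 1)) => g (G c.1.1 c.1.2 s) (c.2 s))
  have hrec : ∀ x (s : Fin (n + 1)), P ((v + (s : ℕ) • e) +ᵥ x) =
      G (P (v +ᵥ x)) (fun j : Fin n => F ((v + ((j : ℕ) + 1) • e) +ᵥ x)) s := fun x s => by
    have h := hG (fun s => P ((v + s • e) +ᵥ x)) (fun s => F ((v + (s + 1) • e) +ᵥ x))
      (fun s => by
        have : (v + (s + 1) • e) +ᵥ x = e +ᵥ ((v + s • e) +ᵥ x) := by
          rw [vadd_vadd]; congr 1; rw [add_smul, one_smul]; abel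
        simp only [this]
        exact hstep _) s (Nat.lt_succ_iff.mp s.2)
    simpa using h
  simp_rw [hrec]
  refine hmono.trans ((partitionEntropy_prodMk_le hPF (measurableSet_fiber_pi hE')).trans
    (add_le_add ((partitionEntropy_prodMk_le (measurableSet_fiber_vadd hP v)
      (measurableSet_fiber_pi hF')).trans (add_le_add ?_ ?_)) ?_))
  · rw [partitionEntropy_vadd]
  · refine (partitionEntropy_pi_le hF').trans (le_of_eq ?_)
    simp_rw [partitionEntropy_vadd]
    simp
  · refine (partitionEntropy_pi_le hE').trans (le_of_eq ?_)
    simp_rw [partitionEntropy_vadd]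
    simp

/-- If all lattice points of `K` lie within distance `N` of the origin in direction `i` and project
into `C`, then names over `K` are determined by the names of `joinPartition C P` along a line. -/
theorem partitionEntropy_joinPartition_le_line {P : X → L}
    (hP : ∀ a, MeasurableSet (P ⁻¹' {a})) (K C : Finset (Fin d → ℤ)) (i : Fin d) (N : ℕ)
    (hK : ∀ w ∈ K, |w i| ≤ N) (hC : ∀ w ∈ K, w - w i • Pi.single i 1 ∈ C) :
    partitionEntropy μ (joinPartition K P) ≤
      partitionEntropy μ (fun x (s : Fin (2 * N + 1)) => joinPartition C P
        ((-((N : ℤ) • (Pi.single i 1 : Fin d → ℤ)) + (s : ℕ) • Pi.single i 1) +ᵥ x)) := by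
  have hC' := measurableSet_fiber_joinPartition hP C
  have h := partitionEntropy_comp_le (μ := μ)
    (measurableSet_fiber_pi fun s : Fin (2 * N + 1) => measurableSet_fiber_vadd hC'
      (-((N : ℤ) • (Pi.single i 1 : Fin d → ℤ)) + (s : ℕ) • Pi.single i 1))
    -- The line starts at `-N e_i`, so the coordinate `w i` is reached at time `w i + N`, and the
    -- remaining offset lies in `C`.
    (fun c (w : K) => c ⟨((w : Fin d → ℤ) i + N).toNat, by
      have := abs_le.mp (hK w w.2); omega⟩ ⟨_, hC w w.2⟩)
  refine le_of_eq_of_le ?_ h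
  congr 1
  funext x w
  simp only [joinPartition]
  rw [vadd_vadd]
  congr 2
  have := abs_le.mp (hK w w.2)
  rw [← natCast_zsmul, Int.toNat_of_nonneg (by omega), add_smul]
  abel

end Line

/-! ### Labels of a tower -/

section Tower

variable {d : ℕ} {X : Type*} [MeasurableSpace X] {μ : Measure X}
  [AddAction (Fin d → ℤ) X] {R : Finset (Fin d → ℤ)} {B : Set X}

open Classical in
/-- The level of the tower of shape `R` and base `B` that contains a point. -/
noncomputable def towerLabel (R : Finset (Fin d → ℤ)) (B : Set X) (x : X) : Option R :=
  if h : ∃ v : R, x ∈ (v : Fin d → ℤ) +ᵥ B then some h.choose else none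

theorem towerLabel_eq_some_iff (hB : IsTowerBase μ R B) {x : X} {v : R} :
    towerLabel R B x = some v ↔ x ∈ (v : Fin d → ℤ) +ᵥ B := by
  unfold towerLabel
  split_ifs with h
  · rw [Option.some_inj]
    refine ⟨fun hv => hv ▸ h.choose_spec, fun hv => ?_⟩
    by_contra hne
    exact Set.disjoint_left.mp (hB.disjoint _ h.choose.2 v v.2 fun h' => hne (Subtype.ext h'))
      h.choose_spec hv
  · simp only [false_iff]
    exact fun hv => h ⟨v, hv⟩

theorem preimage_towerLabel (hB : IsTowerBase μ R B) (a : Option R) :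
    towerLabel R B ⁻¹' {a} = towerAtom R B a := by
  ext x
  rw [Set.mem_preimage, Set.mem_singleton_iff]
  cases a with
  | some v => exact towerLabel_eq_some_iff hB
  | none =>
    rw [Option.eq_none_iff_forall_ne_some]
    simp only [ne_eq, towerLabel_eq_some_iff hB, towerAtom, Set.mem_compl_iff, Set.mem_iUnion,
      not_exists, Subtype.forall]

theorem measurableSet_fiber_towerLabel [MeasurableConstVAdd (Fin d → ℤ) X]
    (hB : IsTowerBase μ R B) (a : Option R) : MeasurableSet (towerLabel R B ⁻¹' {a}) := by
  rw [preimage_towerLabel hB]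
  cases a with
  | some v => exact hB.measurableSet.const_vadd _
  | none =>
    exact (Finset.measurableSet_biUnion _ fun v _ => hB.measurableSet.const_vadd _).compl

/-- The level of a point in the tower, if it lies in the face `v i = c`. -/
noncomputable def faceLabel (i : Fin d) (c : ℤ) (R : Finset (Fin d → ℤ)) (B : Set X) (x : X) :
    Option R :=
  (towerLabel R B x).filter fun v => v.1 i = c

theorem measurableSet_fiber_faceLabel [MeasurableConstVAdd (Fin d → ℤ) X]
    (hB : IsTowerBase μ R B) (i : Fin d) (c : ℤ) (a : Option R) :
    MeasurableSet (faceLabel i c R B ⁻¹' {a}) := by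
  have : faceLabel i c R B ⁻¹' {a} =
      ⋃ b ∈ {b : Option R | b.filter (fun v => v.1 i = c) = a}, towerLabel R B ⁻¹' {b} := by
    ext x; simp [faceLabel]
  rw [this]
  exact MeasurableSet.biUnion (Set.to_countable _) fun b _ => measurableSet_fiber_towerLabel hB b

open Classical in
/-- The label after a step by `e`, given the label before it and the entrance label. -/
noncomputable def nextLabel (e : Fin d → ℤ) (R : Finset (Fin d → ℤ)) :
    Option R → Option R → Option R
  | _, some v => some v
  | none, none => none
  | some v, none => if h : (v : Fin d → ℤ) + e ∈ R then some ⟨_, h⟩ else none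

theorem mem_vadd_iff_vadd_mem_add_vadd {d : ℕ} {X : Type*} [AddAction (Fin d → ℤ) X]
    {B : Set X} (e v : Fin d → ℤ) (x : X) :
    x ∈ v +ᵥ B ↔ e +ᵥ x ∈ (v + e) +ᵥ B := by
  rw [add_comm, ← vadd_vadd, Set.vadd_mem_vadd_set_iff]

/-- In a rectangle, a level off the face `v i = m i` can only be entered from the level below it in
direction `e_i`. Knowing the entrance label therefore removes all uncertainty about the next level.
-/
theorem towerLabel_single_vadd {m n : Fin d → ℤ} (hB : IsTowerBase μ (Finset.Icc m n) B)
    (i : Fin d) (x : X) :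
    towerLabel (Finset.Icc m n) B ((Pi.single i 1 : Fin d → ℤ) +ᵥ x) =
      nextLabel (Pi.single i 1) _ (towerLabel _ B x)
        (faceLabel i (m i) _ B ((Pi.single i 1 : Fin d → ℤ) +ᵥ x)) := by
  set e : Fin d → ℤ := Pi.single i 1 with he
  rcases h : towerLabel (Finset.Icc m n) B (e +ᵥ x) with _ | v
  · rcases h' : towerLabel (Finset.Icc m n) B x with _ | v
    · simp [faceLabel, h, nextLabel]
    -- A point that leaves the tower must have been on an exit level, as otherwise its image would
    -- lie in the next level.
    · have : (v : Fin d → ℤ) + e ∉ Finset.Icc m n := fun hv => by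
        have h1 := (mem_vadd_iff_vadd_mem_add_vadd e _ x).mp ((towerLabel_eq_some_iff hB).mp h')
        have h2 := (towerLabel_eq_some_iff hB (v := ⟨_, hv⟩)).mpr h1
        rw [h] at h2
        cases h2
      simp only [faceLabel, h, Option.filter_none, nextLabel, dif_neg this]
  · by_cases hv : v.1 i = m i
    · rw [faceLabel, h, Option.filter_some_pos (by simpa using hv), nextLabel]
    · obtain ⟨hm, hn⟩ := Finset.mem_Icc.mp v.2
      have hmem : v.1 - e ∈ Finset.Icc m n := by
        rw [Finset.mem_Icc]
        constructor <;> intro j <;> have h1 : m j ≤ v.1 j := hm j <;>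
          have h2 : v.1 j ≤ n j := hn j <;>
          rcases eq_or_ne j i with rfl | hj
        · have : m j < v.1 j := lt_of_le_of_ne h1 (Ne.symm hv)
          simp [he]; omega
        · simpa [he, hj] using h1
        · simp [he]; omega
        · simpa [he, hj] using h2
      have h1 : towerLabel (Finset.Icc m n) B x = some ⟨_, hmem⟩ := by
        rw [towerLabel_eq_some_iff hB, mem_vadd_iff_vadd_mem_add_vadd e]
        simpa using (towerLabel_eq_some_iff hB).mp h
      rw [h1, faceLabel, h, Option.filter_some_neg (by simpa using hv), nextLabel]
      simp

theorem card_mul_measureReal_base_le_one [IsProbabilityMeasure μ]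
    [MeasurableConstVAdd (Fin d → ℤ) X] [VAddInvariantMeasure (Fin d → ℤ) X μ]
    (hB : IsTowerBase μ R B) : R.card * μ.real B ≤ 1 := by
  have h := measureReal_biUnion_finset (μ := μ) (s := R) (f := fun v => v +ᵥ B)
    (fun v hv w hw hvw => hB.disjoint v hv w hw hvw) (fun v _ => hB.measurableSet.const_vadd v)
  simp only [Measure.real, measure_vadd, Finset.sum_const, nsmul_eq_mul] at h
  rw [Measure.real, ← h]
  exact measureReal_le_one

end Tower

/-! ### Rectangles -/

section Rectangle

variable {d : ℕ} {m n : Fin d → ℤ}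

theorem card_face_mul (hmn : m ≤ n) (i : Fin d) :
    (((Finset.Icc m n).filter fun v => v i = m i).card : ℝ) * (n i - m i + 1) =
      ((Finset.Icc m n).card : ℝ) := by
  have hface : (Finset.Icc m n).filter (fun v => v i = m i) =
      Finset.Icc m (Function.update n i (m i)) := by
    ext v
    simp only [Finset.mem_filter, Finset.mem_Icc, le_update_iff]
    constructor
    · rintro ⟨⟨h1, h2⟩, h3⟩
      exact ⟨h1, h3.le, fun j _ => h2 j⟩
    · rintro ⟨h1, h2, h3⟩
      refine ⟨⟨h1, fun j => ?_⟩, le_antisymm h2 (h1 i)⟩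
      rcases eq_or_ne j i with rfl | hj
      · exact h2.trans (hmn j)
      · exact h3 j hj
  have hl : ((n i - m i + 1 : ℤ).toNat : ℤ) = n i - m i + 1 :=
    Int.toNat_of_nonneg (by have : m i ≤ n i := hmn i; omega)
  have key : ((Finset.Icc m n).filter fun v => v i = m i).card * (n i - m i + 1 : ℤ).toNat =
      (Finset.Icc m n).card := by
    rw [hface, Pi.card_Icc, Pi.card_Icc, ← Finset.mul_prod_erase _ _ (Finset.mem_univ i),
      ← Finset.mul_prod_erase (s := Finset.univ) (f := fun j => (Finset.Icc (m j) (n j)).card)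
        (Finset.mem_univ i)]
    rw [Finset.prod_congr rfl (g := fun j => (Finset.Icc (m j) (n j)).card) fun j hj => by
      rw [Function.update_of_ne (Finset.ne_of_mem_erase hj)]]
    simp only [Function.update_self, Int.card_Icc]
    have h1 : (m i + 1 - m i).toNat = 1 := by omega
    rw [h1, one_mul, mul_comm]
    congr 2
    omega
  have hl' : (((n i - m i + 1 : ℤ).toNat : ℕ) : ℝ) = n i - m i + 1 := by
    exact_mod_cast congrArg (Int.cast : ℤ → ℝ) hl
  rw [← hl']
  exact_mod_cast key

/-- Being a longest side matters only here: it bounds `log |R|` by `d` times the logarithm of that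
side. -/
theorem card_Icc_le_pow {i : Fin d} (hi : ∀ j, n j - m j ≤ n i - m i) (hmn : m ≤ n) :
    ((Finset.Icc m n).card : ℝ) ≤ ((n i : ℝ) - m i + 1) ^ d := by
  have hl : ((n i - m i + 1 : ℤ).toNat : ℤ) = n i - m i + 1 :=
    Int.toNat_of_nonneg (by have : m i ≤ n i := hmn i; omega)
  have hl' : (((n i - m i + 1 : ℤ).toNat : ℕ) : ℝ) = n i - m i + 1 := by
    exact_mod_cast congrArg (Int.cast : ℤ → ℝ) hl
  rw [← hl', Pi.card_Icc]
  have h := Finset.prod_le_pow_card (Finset.univ : Finset (Fin d))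
    (fun j => (Finset.Icc (m j) (n j)).card) (n i - m i + 1 : ℤ).toNat fun j _ => by
      rw [Int.card_Icc]; have := hi j; omega
  rw [Finset.card_univ, Fintype.card_fin] at h
  exact_mod_cast h

/-- The translate by `e_i` misses the face `v i = m i`, so the symmetric difference contains this
face, whose share of the rectangle is the inverse side length. -/
theorem inv_side_le_folner (hmn : m ≤ n) (i : Fin d) :
    ((n i : ℝ) - m i + 1)⁻¹ ≤ ((Finset.Icc m n ∆
      (Finset.Icc m n).image fun v => v + Pi.single i 1).card : ℝ) / (Finset.Icc m n).card := by
  have hl : (0 : ℝ) < (n i : ℝ) - m i + 1 := by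
    have : (m i : ℝ) ≤ n i := by exact_mod_cast hmn i
    linarith
  have hR : (0 : ℝ) < (Finset.Icc m n).card := by
    exact_mod_cast Finset.card_pos.mpr ⟨m, Finset.mem_Icc.mpr ⟨le_rfl, hmn⟩⟩
  rw [le_div_iff₀ hR, ← card_face_mul hmn i, mul_comm, mul_assoc, mul_inv_cancel₀ hl.ne', mul_one]
  norm_cast
  refine Finset.card_le_card fun v hv => ?_
  obtain ⟨hv, hvi⟩ := Finset.mem_filter.mp hv
  rw [Finset.mem_symmDiff]
  refine Or.inl ⟨hv, fun h => ?_⟩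
  obtain ⟨w, hw, rfl⟩ := Finset.mem_image.mp h
  have hwi : m i ≤ w i := (Finset.mem_Icc.mp hw).1 i
  simp only [Pi.add_apply, Pi.single_eq_same] at hvi
  omega

end Rectangle

/-! ### Approximation of partitions -/

section Approximation

variable {X : Type*} [MeasurableSpace X] {μ : Measure X}

/-- If `P_k → ε`, then every finite partition is approximated by functions of `P_k`. -/
theorem TendstoPoints.eventually_exists_comp [IsFiniteMeasure μ] {L : Type*} [Fintype L]
    [Nonempty L] {A : ℕ → Type*} {P : ∀ k, X → A k} (h : TendstoPoints μ fun k a => P k ⁻¹' {a})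
    {Q : X → L} (hQ : ∀ a, MeasurableSet (Q ⁻¹' {a})) {δ : ℝ} (hδ : 0 < δ) :
    ∀ᶠ k in atTop, ∃ g : A k → L, μ.real {x | Q x ≠ g (P k x)} ≤ δ := by
  classical
  choose I hI using fun a => h (Q ⁻¹' {a}) (hQ a)
  have hlim : Tendsto (fun k => ∑ a, μ ((⋃ c ∈ I a k, P k ⁻¹' {c}) ∆ (Q ⁻¹' {a}))) atTop
      (𝓝 0) := by
    simpa using tendsto_finsetSum Finset.univ fun a _ => hI a
  filter_upwards [hlim.eventually (ge_mem_nhds (ENNReal.ofReal_pos.mpr hδ))] with k hk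
  -- An atom goes to any label whose approximating union contains it, and to an arbitrary label if
  -- there is none. A point with a wrong label then lies in the symmetric difference for the chosen
  -- label or for its true label `Q x`.
  refine ⟨fun c => if h : ∃ a, c ∈ I a k then h.choose else Classical.arbitrary L, ?_⟩
  refine ENNReal.toReal_le_of_le_ofReal hδ.le (le_trans ?_ hk)
  refine (measure_mono fun x hx => ?_).trans (measure_iUnion_fintype_le _ _)
  rw [Set.mem_iUnion]
  by_cases hQx : P k x ∈ I (Q x) k
  · have hex : ∃ a, P k x ∈ I a k := ⟨_, hQx⟩
    simp only [Set.mem_ofPred_eq, dif_pos hex] at hx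
    refine ⟨hex.choose, Or.inl ⟨?_, fun h => hx h⟩⟩
    simpa using hex.choose_spec
  · refine ⟨Q x, Or.inr ⟨rfl, ?_⟩⟩
    simpa using hQx

open Classical in
/-- The correction that turns the approximation `Q'` into `Q`. -/
noncomputable def correction {L : Type*} (Q Q' : X → L) (x : X) : Option L :=
  if Q x = Q' x then none else some (Q x)

theorem getD_correction {X L : Type*} (Q Q' : X → L) (x : X) :
    (correction Q Q' x).getD (Q' x) = Q x := by
  unfold correction
  split_ifs with h <;> simp [h]

theorem measurableSet_fiber_correction {L : Type*} [Fintype L] {Q Q' : X → L}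
    (hQ : ∀ a, MeasurableSet (Q ⁻¹' {a})) (hQ' : ∀ a, MeasurableSet (Q' ⁻¹' {a}))
    (c : Option L) : MeasurableSet (correction Q Q' ⁻¹' {c}) := by
  classical
  have : correction Q Q' ⁻¹' {c} = ⋃ p ∈ {p : L × L | (if p.1 = p.2 then none else some p.1) = c},
      (fun x => (Q x, Q' x)) ⁻¹' {p} := by
    ext x; simp [correction]
  rw [this]
  exact MeasurableSet.biUnion (Set.to_countable _) fun p _ =>
    measurableSet_fiber_prodMk hQ hQ' p

theorem partitionEntropy_correction_le [IsProbabilityMeasure μ] {L : Type*} [Fintype L]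
    {Q Q' : X → L} (hQ : ∀ a, MeasurableSet (Q ⁻¹' {a})) (hQ' : ∀ a, MeasurableSet (Q' ⁻¹' {a}))
    {δ : ℝ} (hδ : δ ≤ Real.exp (-1)) (h : μ.real {x | Q x ≠ Q' x} ≤ δ) :
    partitionEntropy μ (correction Q Q') ≤ Fintype.card L * (Real.negMulLog δ + δ) := by
  refine partitionEntropy_option_le (measurableSet_fiber_correction hQ hQ') Finset.univ
    (fun a ha => absurd (Finset.mem_univ a) ha) hδ fun a => (measureReal_mono ?_).trans h
  intro x hx h'
  simp [correction, h'] at hx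

end Approximation

/-! ### Sublinear entropy of names along a longest side -/

section RankOneEntropy

variable {d : ℕ} {X : Type*} [MeasurableSpace X] {μ : Measure X} [IsProbabilityMeasure μ]
  [AddAction (Fin d → ℤ) X] [MeasurableConstVAdd (Fin d → ℤ) X]
  [VAddInvariantMeasure (Fin d → ℤ) X μ]

/-- The partition into the levels of an entrance face of a rectangular tower has small entropy
if the tower is long in the corresponding direction. -/
theorem partitionEntropy_faceLabel_le {m n : Fin d → ℤ} {B : Set X}
    (hB : IsTowerBase μ (Finset.Icc m n) B) (hmn : m ≤ n) {i : Fin d}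
    (hi : ∀ j, n j - m j ≤ n i - m i) {y : ℝ} (hy : y = ((n i : ℝ) - m i + 1)⁻¹)
    (hye : y ≤ Real.exp (-1)) :
    partitionEntropy μ (faceLabel i (m i) (Finset.Icc m n) B) ≤ d * Real.negMulLog y + y := by
  set R := Finset.Icc m n with hRdef
  set l : ℝ := (n i : ℝ) - m i + 1 with hl
  have hl1 : 1 ≤ l := by
    have : (m i : ℝ) ≤ n i := by exact_mod_cast hmn i
    linarith
  have hl0 : 0 < l := by linarith
  have hmem : m ∈ R := Finset.mem_Icc.mpr ⟨le_rfl, hmn⟩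
  have hR : (0 : ℝ) < R.card := by exact_mod_cast Finset.card_pos.mpr ⟨m, hmem⟩
  have hface := card_face_mul hmn i
  have hpow := card_Icc_le_pow hi hmn
  rw [← hRdef, ← hl] at hface hpow
  set K := (R.filter fun v => v i = m i).card
  have hK : (1 : ℝ) ≤ K := by
    exact_mod_cast Finset.card_pos.mpr ⟨m, (Finset.mem_filter (p := fun v => v i = m i)).mpr ⟨hmem, rfl⟩⟩
  -- `negMulLog` is increasing only up to `exp (-1)`; the bound passes from `y` to `1 / |R|` because
  -- `|R|` is at least the side length.
  have hq : ((R.card : ℝ))⁻¹ ≤ Real.exp (-1) := by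
    refine le_trans ?_ hye
    rw [hy]
    refine inv_anti₀ hl0 ?_
    rw [← hface]; nlinarith
  have hbase := card_mul_measureReal_base_le_one hB
  have h := partitionEntropy_option_le (μ := μ) (measurableSet_fiber_faceLabel hB i (m i))
    (Finset.univ.filter fun v : R => v.1 i = m i) (fun v hv => by
      ext x
      simp only [Finset.mem_filter, Finset.mem_univ, true_and] at hv
      simp [faceLabel, Option.filter_eq_some_iff, hv]) hq (fun v => by
      have hsub : faceLabel i (m i) R B ⁻¹' {some v} ⊆ v.1 +ᵥ B := fun x hx => by
        simp only [faceLabel, Set.mem_preimage, Set.mem_singleton_iff,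
          Option.filter_eq_some_iff] at hx
        exact (towerLabel_eq_some_iff hB).mp hx.1
      refine (measureReal_mono hsub).trans ?_
      rw [Measure.real, measure_vadd, ← Measure.real, ← one_div, le_div_iff₀ hR]
      linarith)
  have hcard : (Finset.univ.filter fun v : R => v.1 i = m i).card ≤ K :=
    Finset.card_le_card_of_injOn Subtype.val (fun v hv => by simpa using hv)
      Subtype.val_injective.injOn
  refine h.trans ?_
  have hR1 : (1 : ℝ) ≤ R.card := by rw [← hface]; nlinarith
  have hlogR : 0 ≤ Real.log R.card := Real.log_nonneg hR1
  have hnm : Real.negMulLog ((R.card : ℝ))⁻¹ + ((R.card : ℝ))⁻¹ =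
      ((R.card : ℝ))⁻¹ * (Real.log R.card + 1) := by
    rw [Real.negMulLog, Real.log_inv]; ring
  have hlog : Real.log R.card ≤ d * Real.log l := by
    rw [← Real.log_pow]; exact Real.log_le_log hR hpow
  have hKR : (K : ℝ) * ((R.card : ℝ))⁻¹ = y := by
    rw [← hface, hy]; field_simp
  calc _ ≤ (K : ℝ) * (Real.negMulLog ((R.card : ℝ))⁻¹ + ((R.card : ℝ))⁻¹) := by
        rw [hnm]
        exact mul_le_mul_of_nonneg_right (by exact_mod_cast hcard) (by positivity)
    _ = y * (Real.log R.card + 1) := by rw [hnm, ← mul_assoc, hKR]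
    _ ≤ y * (d * Real.log l + 1) :=
        mul_le_mul_of_nonneg_left (by linarith) (by rw [hy]; positivity)
    _ = _ := by rw [hy, Real.negMulLog, Real.log_inv]; ring

/-- The entropy of the names of length `n + 1` along the `i`-th axis grows sublinearly. -/
theorem exists_partitionEntropy_line_le {m n : ℕ → Fin d → ℤ} (hmn : ∀ k, m k ≤ n k)
    (hF : IsFolner fun k => Finset.Icc (m k) (n k))
    (hR : IsRankOne μ fun k => Finset.Icc (m k) (n k)) {i : Fin d}
    (hi : ∃ᶠ k in atTop, ∀ j, n k j - m k j ≤ n k i - m k i)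
    {L : Type*} [Fintype L] {Q : X → L} (hQ : ∀ a, MeasurableSet (Q ⁻¹' {a}))
    {ε : ℝ} (hε : 0 < ε) :
    ∃ c : ℝ, ∀ (N : ℕ) (v : Fin d → ℤ), partitionEntropy μ (fun x (s : Fin (N + 1)) =>
      Q ((v + (s : ℕ) • (Pi.single i 1 : Fin d → ℤ)) +ᵥ x)) ≤ c + N * ε := by
  obtain ⟨B, hB, hP⟩ := hR
  have : Nonempty L := (nonempty_of_isProbabilityMeasure μ).map Q
  have hP' : TendstoPoints μ fun k a => towerLabel (Finset.Icc (m k) (n k)) (B k) ⁻¹' {a} := by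
    simpa only [preimage_towerLabel (hB _)] using hP
  have hε2 : 0 < ε / 2 := by positivity
  obtain ⟨δ, hδ0, hδe, hδ⟩ : ∃ δ : ℝ, 0 < δ ∧ δ ≤ Real.exp (-1) ∧
      Fintype.card L * (Real.negMulLog δ + δ) ≤ ε / 2 := by
    have hc : Tendsto (fun δ : ℝ => Fintype.card L * (Real.negMulLog δ + δ)) (𝓝[>] 0) (𝓝 0) := by
      have : Continuous fun δ : ℝ => Fintype.card L * (Real.negMulLog δ + δ) := by fun_prop
      simpa using (this.tendsto 0).mono_left nhdsWithin_le_nhds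
    have h1 := hc.eventually (ge_mem_nhds hε2)
    have h2 : ∀ᶠ δ : ℝ in 𝓝[>] 0, δ ≤ Real.exp (-1) :=
      nhdsWithin_le_nhds (ge_mem_nhds (Real.exp_pos _))
    obtain ⟨δ, h⟩ := ((h1.and h2).and self_mem_nhdsWithin).exists
    exact ⟨δ, h.2, h.1.2, h.1.1⟩
  have hy : Tendsto (fun k => ((n k i : ℝ) - m k i + 1)⁻¹) atTop (𝓝 0) := by
    refine squeeze_zero (fun k => ?_) (fun k => inv_side_le_folner (hmn k) i)
      (hF (Pi.single i 1))
    have : (m k i : ℝ) ≤ n k i := by exact_mod_cast hmn k i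
    exact inv_nonneg.mpr (by linarith)
  have hface : Tendsto (fun k => d * Real.negMulLog ((n k i : ℝ) - m k i + 1)⁻¹ +
      ((n k i : ℝ) - m k i + 1)⁻¹) atTop (𝓝 0) := by
    have : Continuous fun y : ℝ => d * Real.negMulLog y + y := by fun_prop
    have h0 := (this.tendsto 0).comp hy
    simpa [Function.comp_def] using h0
  -- A single tower serves all `N`. Side `i` is a longest one for infinitely many `k` only, while
  -- the other requirements hold eventually.
  obtain ⟨k, hik, ⟨⟨g, hg⟩, hk1⟩, hk2⟩ :=
    (hi.and_eventually (((hP'.eventually_exists_comp hQ hδ0).and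
      (hy.eventually (ge_mem_nhds (Real.exp_pos (-1))))).and
      (hface.eventually (ge_mem_nhds hε2)))).exists
  set P := towerLabel (Finset.Icc (m k) (n k)) (B k) with hPdef
  have hPm : ∀ a, MeasurableSet (P ⁻¹' {a}) := measurableSet_fiber_towerLabel (hB k)
  have hQ' : ∀ a, MeasurableSet ((fun x => g (P x)) ⁻¹' {a}) := fun a => by
    have : (fun x => g (P x)) ⁻¹' {a} = ⋃ b ∈ g ⁻¹' {a}, P ⁻¹' {b} := by ext x; simp
    rw [this]
    exact MeasurableSet.biUnion (Set.to_countable _) fun b _ => hPm b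
  have hE := partitionEntropy_correction_le hQ hQ' hδe hg
  have hFl := partitionEntropy_faceLabel_le (hB k) (hmn k) hik rfl hk1
  -- There are `N` entrance labels but `N + 1` corrections, each costing at most `ε / 2`; the
  -- surplus correction goes into the constant.
  refine ⟨partitionEntropy μ P + ε / 2, fun N v => ?_⟩
  have h := partitionEntropy_line_le (μ := μ) hPm
    (measurableSet_fiber_faceLabel (hB k) i (m k i)) (measurableSet_fiber_correction hQ hQ')
    (Pi.single i 1) (nextLabel (Pi.single i 1) _) (towerLabel_single_vadd (hB k) i)
    (fun a c => c.getD (g a)) v N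
  simp only [fun x => getD_correction Q (fun x => g (P x)) x] at h
  have hN : (0 : ℝ) ≤ N := Nat.cast_nonneg N
  nlinarith [mul_le_mul_of_nonneg_left (hFl.trans hk2) hN,
    mul_le_mul_of_nonneg_left (hE.trans hδ) (add_nonneg hN zero_le_one)]

end RankOneEntropy

/-! ### Boxes along a coordinate axis -/

section Axis

variable {d : ℕ}

theorem norm_sum_smul_orthonormal_le {E ι : Type*} [NormedAddCommGroup E] [InnerProductSpace ℝ E]
    [Fintype ι] {V : Submodule ℝ E} (b : OrthonormalBasis ι ℝ V) {s : ι → ℝ}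
    (hs : ∀ j, |s j| ≤ 1) : ‖∑ j, s j • (b j : E)‖ ≤ Fintype.card ι := by
  refine (norm_sum_le _ _).trans ?_
  have : ∀ j ∈ Finset.univ, ‖s j • (b j : E)‖ ≤ 1 := fun j _ => by
    rw [norm_smul, Real.norm_eq_abs, ← Submodule.coe_norm, b.orthonormal.1 j, mul_one]
    exact hs j
  simpa using Finset.sum_le_card_nsmul _ _ _ this

/-- The part of the box in `V` contributes only to coordinate `i` and the part in `Vᗮ` only to the
others. The factor `d` is a crude bound for the norm on the unit cube of `Vᗮ`. -/
theorem abs_le_of_mem_latticeBox_axis {i : Fin d}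
    (b : OrthonormalBasis (Fin (Module.finrank ℝ
      (Submodule.span ℝ {EuclideanSpace.single i (1 : ℝ)}))) ℝ
      (Submodule.span ℝ {EuclideanSpace.single i (1 : ℝ)}))
    (b' : OrthonormalBasis (Fin (Module.finrank ℝ
      (Submodule.span ℝ {EuclideanSpace.single i (1 : ℝ)})ᗮ)) ℝ
      (Submodule.span ℝ {EuclideanSpace.single i (1 : ℝ)})ᗮ)
    {t r : ℝ} (ht : 0 ≤ t) (hr : 0 ≤ r) {w : Fin d → ℤ} (hw : w ∈ latticeBox b b' t r) :
    |(w i : ℝ)| ≤ t ∧ ∀ j ≠ i, |(w j : ℝ)| ≤ r * d := by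
  rw [latticeBox, Set.Finite.mem_toFinset, Set.mem_ofPred_eq, tiltedBox, Set.mem_add] at hw
  obtain ⟨_, ⟨_, ⟨s, hs, rfl⟩, rfl⟩, _, ⟨_, ⟨s', hs', rfl⟩, rfl⟩, hw⟩ := hw
  set p : EuclideanSpace ℝ (Fin d) := ∑ j, s j • (b j : EuclideanSpace ℝ (Fin d)) with hp
  set q : EuclideanSpace ℝ (Fin d) := ∑ j, s' j • (b' j : EuclideanSpace ℝ (Fin d)) with hq
  have hcoord : ∀ j, (w j : ℝ) = t * p j + r * q j := fun j => by
    have := congrArg (fun u : EuclideanSpace ℝ (Fin d) => u j) hw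
    simpa only [PiLp.add_apply, PiLp.smul_apply, smul_eq_mul] using this.symm
  have hpV : p ∈ Submodule.span ℝ {EuclideanSpace.single i (1 : ℝ)} :=
    Submodule.sum_mem _ fun j _ => Submodule.smul_mem _ _ (b j).2
  have hqV : q ∈ (Submodule.span ℝ {EuclideanSpace.single i (1 : ℝ)})ᗮ :=
    Submodule.sum_mem _ fun j _ => Submodule.smul_mem _ _ (b' j).2
  have hqi : q i = 0 := by
    have := Submodule.mem_orthogonal_singleton_iff_inner_right.mp hqV
    simpa [EuclideanSpace.inner_single_left] using this
  have hpj : ∀ j ≠ i, p j = 0 := fun j hj => by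
    obtain ⟨c, hc⟩ := Submodule.mem_span_singleton.mp hpV
    rw [← hc]
    simp [hj]
  have hpn : ‖p‖ ≤ 1 := by
    refine (norm_sum_smul_orthonormal_le b fun j => ?_).trans (le_of_eq ?_)
    · exact abs_le.mpr ⟨by linarith [show (0 : ℝ) ≤ s j from hs.1 j], hs.2 j⟩
    · rw [Fintype.card_fin, finrank_span_singleton (by simp)]; simp
  have hqn : ‖q‖ ≤ d := by
    refine (norm_sum_smul_orthonormal_le b' fun j => ?_).trans ?_
    · have h1 : -(1 / 2 : ℝ) ≤ s' j := hs'.1 j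
      have h2 : s' j ≤ 1 / 2 := hs'.2 j
      exact abs_le.mpr ⟨by linarith, by linarith⟩
    · rw [Fintype.card_fin]
      have := Submodule.finrank_le (Submodule.span ℝ {EuclideanSpace.single i (1 : ℝ)})ᗮ
      rw [finrank_euclideanSpace_fin] at this
      exact_mod_cast this
  constructor
  · rw [hcoord, hqi, mul_zero, add_zero, abs_mul, abs_of_nonneg ht]
    exact mul_le_of_le_one_right ht ((PiLp.norm_apply_le p i).trans hpn)
  · intro j hj
    rw [hcoord, hpj j hj, mul_zero, zero_add, abs_mul, abs_of_nonneg hr]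
    exact mul_le_mul_of_nonneg_left ((PiLp.norm_apply_le q j).trans hqn) hr

variable {X : Type*} [MeasurableSpace X] {μ : Measure X} [IsProbabilityMeasure μ]
  [AddAction (Fin d → ℤ) X] [MeasurableConstVAdd (Fin d → ℤ) X]
  [VAddInvariantMeasure (Fin d → ℤ) X μ]

/-- The directional entropy vanishes in the direction of a longest side of the rectangles. -/
theorem directionalEntropy_axis_eq_zero {m n : ℕ → Fin d → ℤ} (hmn : ∀ k, m k ≤ n k)
    (hF : IsFolner fun k => Finset.Icc (m k) (n k))
    (hR : IsRankOne μ fun k => Finset.Icc (m k) (n k)) {i : Fin d}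
    (hi : ∃ᶠ k in atTop, ∀ j, n k j - m k j ≤ n k i - m k i) :
    directionalEntropy μ (Submodule.span ℝ {EuclideanSpace.single i (1 : ℝ)}) = 0 := by
  simp only [directionalEntropy, ENNReal.iSup_eq_zero]
  intro b b' N P hP r hr
  have hP' : ∀ a, MeasurableSet (P ⁻¹' {a}) := fun a => hP (measurableSet_singleton a)
  set M : ℤ := ⌈r * d⌉ with hM
  -- A cross-section of the tube that does not depend on `t`, so that the join over `C` is one fixed
  -- finite partition.
  set C : Finset (Fin d → ℤ) := Finset.Icc (fun _ => -M) (fun _ => M) with hC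
  have hM0 : 0 ≤ M := Int.ceil_nonneg (by positivity)
  refine le_antisymm (ENNReal.le_of_forall_pos_le_add fun ε hε _ => ?_) zero_le
  rw [zero_add]
  have hε' : (0 : ℝ) < ε := hε
  -- The line has `2 ⌈t⌉ ≤ 2 (t + 1)` steps, so `ε / 4` per step costs at most `(t + 1) ε / 2`; the
  -- other `t ε / 2` absorbs `c + ε / 2` for large `t`.
  obtain ⟨c, hc⟩ := exists_partitionEntropy_line_le hmn hF hR hi
    (measurableSet_fiber_joinPartition hP' C) (show (0 : ℝ) < ε / 4 by positivity)
  have hev : ∀ᶠ t : ℝ in atTop, 0 < t ∧ c + ε / 2 ≤ t * (ε / 2) :=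
    (eventually_gt_atTop 0).and
      ((tendsto_id.atTop_mul_const (show (0 : ℝ) < ε / 2 by positivity)).eventually_ge_atTop _)
  refine limsup_le_of_le (by isBoundedDefault) ?_
  filter_upwards [hev] with t ⟨ht, htc⟩
  rw [← ENNReal.ofReal_coe_nnreal]
  refine ENNReal.ofReal_le_ofReal ?_
  rw [finrank_span_singleton (by simp), pow_one, div_le_iff₀ ht]
  have hbox : ∀ w ∈ latticeBox b b' t r, |w i| ≤ ⌈t⌉₊ := fun w hw => by
    have h := (abs_le_of_mem_latticeBox_axis b b' ht.le hr.le hw).1.trans (Nat.le_ceil t)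
    exact_mod_cast h
  have hproj : ∀ w ∈ latticeBox b b' t r, w - w i • Pi.single i 1 ∈ C := fun w hw => by
    have hj : ∀ j, |(w - w i • (Pi.single i 1 : Fin d → ℤ)) j| ≤ M := fun j => by
      rcases eq_or_ne j i with rfl | hj
      · simpa using hM0
      · have h := ((abs_le_of_mem_latticeBox_axis b b' ht.le hr.le hw).2 j hj).trans
          (Int.le_ceil _)
        simp only [Pi.sub_apply, Pi.smul_apply, Pi.single_eq_of_ne hj, smul_zero, sub_zero]
        exact_mod_cast h
    exact Finset.mem_Icc.mpr ⟨fun j => (abs_le.mp (hj j)).1, fun j => (abs_le.mp (hj j)).2⟩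
  have h := (partitionEntropy_joinPartition_le_line (μ := μ) hP' _ C i ⌈t⌉₊ hbox hproj).trans
    (hc _ _)
  have hceil : (⌈t⌉₊ : ℝ) ≤ t + 1 := (Nat.ceil_lt_add_one ht.le).le
  push_cast at h
  nlinarith

end Axis

end RankOne

theorem theorem4p1 {d : ℕ} (hd : 1 ≤ d) {X : Type*} [MeasurableSpace X]
    (μ : MeasureTheory.Measure X) [MeasureTheory.IsProbabilityMeasure μ]
    (hX : RankOne.IsLebesgueSpace μ)
    [AddAction (Fin d → ℤ) X] [MeasurableConstVAdd (Fin d → ℤ) X]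
    [MeasureTheory.VAddInvariantMeasure (Fin d → ℤ) X μ]
    (hfree : RankOne.IsFree d μ) (hT : RankOne.IsRectangularRankOne d μ) :
    (∃ V : Submodule ℝ (EuclideanSpace ℝ (Fin d)),
      Module.finrank ℝ V = 1 ∧ RankOne.directionalEntropy μ V = 0) ∧
    ∀ m n : ℕ → Fin d → ℤ, (∀ k, m k ≤ n k) →
      RankOne.IsFolner (fun k => Finset.Icc (m k) (n k)) →
      RankOne.IsRankOne μ (fun k => Finset.Icc (m k) (n k)) →
      ∀ i : Fin d,
        (∃ᶠ k in Filter.atTop, ∀ j : Fin d, n k j - m k j ≤ n k i - m k i) →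
        RankOne.directionalEntropy μ
          (Submodule.span ℝ {EuclideanSpace.single i (1 : ℝ)}) = 0 := by
  refine ⟨?_, fun m n hmn hF hR i hi => RankOne.directionalEntropy_axis_eq_zero hmn hF hR hi⟩
  obtain ⟨m, n, hmn, hF, hR⟩ := hT
  have : Nonempty (Fin d) := ⟨⟨0, hd⟩⟩
  have hmax : ∃ᶠ k in Filter.atTop, ∃ i : Fin d, ∀ j : Fin d, n k j - m k j ≤ n k i - m k i :=
    (Filter.Eventually.of_forall fun k => Finite.exists_max fun j => n k j - m k j).frequently
  -- Pigeonhole: there are finitely many coordinates, so one of them gives a longest side for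
  -- infinitely many `k`.
  obtain ⟨i, hi⟩ := Filter.frequently_exists.mp hmax
  exact ⟨_, finrank_span_singleton (by simp),
    RankOne.directionalEntropy_axis_eq_zero hmn hF hR hi⟩
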